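/- Write $\hat t_k=\binom{2k}{k}^3/(-64)^k$ and $t_k=(4k+1)\hat t_k$ for integers $k\ge 0$. For a sequence $t_k$ of nonzero numbers, nonzero polynomials $(a,b,c)$ form a Gosper representation of $t_k$ if $\frac{t_{k+1}}{t_k}=\frac{a(k)}{b(k)}\cdot\frac{c(k+1)}{c(k)}$ for all $k\ge 0$ (with no vanishing denominator) and $\gcd(a(k),b(k+h))=1$ for every integer $h\ge 0$. Then the following hold. (0) Bauer's series: $\sum_{k=0}^\infty (4k+1)\frac{\binom{2k}{k}^3}{(-64)^k}=\frac2\pi$ (as the limit of its partial sums). Moreover $\left(-(2k+1)^3,\;8(k+1)^3,\;4k+1\right)$ is a Gosper representation of $t_k$. In each of (1)–(5) the displayed telescoping relation holds for all $k\ge 0$, $\lim_{k\to\infty} g_i(k)=0$, and the displayed series converges absolutely to the displayed value. (1) With $g_1(k)=-\frac{8k^3}{(2k-1)^2}\hat t_k$, so $g_1(0)=0$: $\;t_k+\frac{8k^2-2k}{(2k-1)^2}\hat t_k=g_1(k+1)-g_1(k)$, and $$\sum_{k=0}^\infty \frac{k(4k-1)}{(2k-1)^2}\frac{\binom{2k}{k}^3}{(-64)^k}=-\frac1\pi.$$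 (2) With $g_2(k)=-2k\,\hat t_k$, so $g_2(0)=0$: $\;t_k-\frac14\frac{(4k+3)(2k+1)}{(k+1)^2}\hat t_k=g_2(k+1)-g_2(k)$, and $$\sum_{k=0}^\infty \frac{(4k+3)(2k+1)}{(k+1)^2}\frac{\binom{2k}{k}^3}{(-64)^k}=\frac8\pi.$$ (3) With $g_3(k)=-\frac{4k^2}{2k-1}\hat t_k$, so $g_3(0)=0$: $\;t_k+\frac12\frac{4k+1}{(k+1)(2k-1)}\hat t_k=g_3(k+1)-g_3(k)$, and $$\sum_{k=0}^\infty \frac{4k+1}{(k+1)(2k-1)}\frac{\binom{2k}{k}^3}{(-64)^k}=-\frac4\pi.$$ (4) With $g_4(k)=-\frac{16k^3(k-1)}{(2k-1)^3}\hat t_k$, so $g_4(0)=0$: $\;t_k-\frac{4k-1}{(2k-1)^3}\hat t_k=g_4(k+1)-g_4(k)$, and $$\sum_{k=0}^\infty \frac{4k-1}{(2k-1)^3}\frac{\binom{2k}{k}^3}{(-64)^k}=\frac2\pi.$$ (5) With $g_5(k)=-(2k+1)\hat t_k$, so $g_5(0)=-1$: $\;t_k+\frac18\frac{4k+3}{(k+1)^3}\hat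 t_k=g_5(k+1)-g_5(k)$, and $$\sum_{k=0}^\infty \frac{4k+3}{(k+1)^3}\frac{\binom{2k}{k}^3}{(-64)^k}=8-\frac{16}{\pi}.$$ -/

import Mathlib

open Filter Topology Polynomial

/-- `(a, b, c)` is a Gosper representation of the (nowhere vanishing) sequence `t`:
`a`, `b`, `c` are nonzero polynomials with `t (k+1) / t k = (a k / b k) * (c (k+1) / c k)` for all
`k`, no denominator vanishing, and `gcd (a(k), b(k+h)) = 1` for every integer `h ≥ 0`. -/
def IsGosperRepresentation {K : Type*} [Field K] (t : ℕ → K) (a b c : K[X]) : Prop :=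
  a ≠ 0 ∧ b ≠ 0 ∧ c ≠ 0 ∧
  (∀ h : ℕ, IsCoprime a (b.comp (X + C (h : K)))) ∧
  (∀ k : ℕ, t k ≠ 0 ∧ b.eval (k : K) ≠ 0 ∧ c.eval (k : K) ≠ 0 ∧
    t (k + 1) / t k =
      (a.eval (k : K) / b.eval (k : K)) * (c.eval ((k : K) + 1) / c.eval (k : K)))

/-- The term `C(2k,k)^3 / (-64)^k`. -/
noncomputable def tHat (k : ℕ) : ℝ := ((2 * k).choose k : ℝ) ^ 3 / (-64 : ℝ) ^ k

/-- The term `(4k+1) C(2k,k)^3 / (-64)^k` of Bauer's series. -/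
noncomputable def bauerTerm (k : ℕ) : ℝ := (4 * (k : ℝ) + 1) * tHat k

/-- `r(k) tHat k` with `r(k) = -8k^3/(2k-1)^2`. -/
noncomputable def g₁ (k : ℕ) : ℝ := -(8 * (k : ℝ) ^ 3 / (2 * (k : ℝ) - 1) ^ 2) * tHat k

/-- `r(k) tHat k` with `r(k) = -2k`. -/
noncomputable def g₂ (k : ℕ) : ℝ := -(2 * (k : ℝ)) * tHat k

/-- `r(k) tHat k` with `r(k) = -4k^2/(2k-1)`. -/
noncomputable def g₃ (k : ℕ) : ℝ := -(4 * (k : ℝ) ^ 2 / (2 * (k : ℝ) - 1)) * tHat k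

/-- `r(k) tHat k` with `r(k) = -16k^3(k-1)/(2k-1)^3`. -/
noncomputable def g₄ (k : ℕ) : ℝ :=
  -(16 * (k : ℝ) ^ 3 * ((k : ℝ) - 1) / (2 * (k : ℝ) - 1) ^ 3) * tHat k

/-- `r(k) tHat k` with `r(k) = -(2k+1)`. -/
noncomputable def g₅ (k : ℕ) : ℝ := -(2 * (k : ℝ) + 1) * tHat k

/-! Bauer's series is the case `a = 1/2` of the very-well-poised family with `a = m + 1/2`. A
Wilf–Zeilberger relation (`veryWellPoisedSum_eq`) expresses the `n`-th partial sum at `m` as a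
factor times the one at `m + 1`, minus a boundary term that vanishes as `n → ∞`. The product of the
first `M` factors is the reciprocal of Wallis's product `W M`, which tends to `2/π`. The sums at
parameter `M` lie within `1/(M+1)` of `1`, uniformly in `n ≥ 1`, because the terms alternate and
decrease. Hence the partial sums at `m = 0` tend to `2/π`.

The five further series follow by telescoping: Bauer's term plus `α r(k) tHat k` is a difference
`g(k+1) - g(k)`. Since `|tHat k|` is at most `(k+1)^(-3/2)`, a bounded `r` gives absolute
convergence and a `g / tHat` of linear growth gives `g → 0`, so the value is `-(g 0 + 2/π)/α`. -/

/-! ### The well-poised terms -/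

/-- The absolute values `(a)_k (1/2)_k ^ 2 / (k! (a + 1/2)_k ^ 2)`, `a = m + 1/2`, of the
well-poised hypergeometric terms deforming `tHat`. -/
noncomputable def wellPoised (m k : ℕ) : ℝ :=
  ∏ i ∈ Finset.range k, ((m : ℝ) + 1 / 2 + i) * ((i : ℝ) + 1 / 2) ^ 2 /
    (((i : ℝ) + 1) * ((m : ℝ) + 1 + i) ^ 2)

/-- The absolute values of the very-well-poised terms, normalized to be `1` at `k = 0`. -/
noncomputable def veryWellPoised (m k : ℕ) : ℝ :=
  ((m : ℝ) + 1 / 2 + 2 * k) / ((m : ℝ) + 1 / 2) * wellPoised m k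

theorem wellPoised_zero (m : ℕ) : wellPoised m 0 = 1 := by simp [wellPoised]

theorem wellPoised_succ (m k : ℕ) : wellPoised m (k + 1) = wellPoised m k *
    (((m : ℝ) + 1 / 2 + k) * ((k : ℝ) + 1 / 2) ^ 2 / (((k : ℝ) + 1) * ((m : ℝ) + 1 + k) ^ 2)) :=
  Finset.prod_range_succ _ _

theorem wellPoised_pos (m k : ℕ) : 0 < wellPoised m k :=
  Finset.prod_pos fun _ _ => by positivity

theorem veryWellPoised_pos (m k : ℕ) : 0 < veryWellPoised m k :=
  mul_pos (by positivity) (wellPoised_pos m k)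

/-- The quotient of consecutive parameters is rational in `k`, which reduces the Wilf–Zeilberger
relation to a rational identity. -/
theorem wellPoised_shift (m k : ℕ) : wellPoised (m + 1) k = wellPoised m k *
    (((m : ℝ) + 1 / 2 + k) / ((m : ℝ) + 1 / 2) * (((m : ℝ) + 1) / ((m : ℝ) + 1 + k)) ^ 2) := by
  induction k with
  | zero =>
    have h1 : (m : ℝ) + 1 / 2 ≠ 0 := by positivity
    have h2 : (m : ℝ) + 1 ≠ 0 := by positivity
    simp [wellPoised_zero, div_self h2]
    field_simp
  | succ k ih =>
    rw [wellPoised_succ, wellPoised_succ, ih]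
    push_cast
    have h1 : (m : ℝ) + 1 / 2 ≠ 0 := by positivity
    have h2 : (m : ℝ) + 1 + k ≠ 0 := by positivity
    have h3 : (m : ℝ) + 1 + (k + 1) ≠ 0 := by positivity
    have h4 : (m : ℝ) + 1 + 1 + k ≠ 0 := by positivity
    field_simp
    ring

/-- Monotonicity in `m` lets the decay at `m = 0` control the boundary terms for every `m`. -/
theorem wellPoised_shift_le (m k : ℕ) : wellPoised (m + 1) k ≤ wellPoised m k := by
  rw [wellPoised_shift]
  refine mul_le_of_le_one_right (wellPoised_pos m k).le ?_
  rw [div_pow, div_mul_div_comm, div_le_one (by positivity)]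
  have hm : (0 : ℝ) ≤ m := m.cast_nonneg
  have hk : (0 : ℝ) ≤ k := k.cast_nonneg
  have h : ((m : ℝ) + 1 / 2) * (m + 1 + k) ^ 2 - (m + 1 / 2 + k) * (m + 1) ^ 2 =
      k * (m + 1) * m + (m + 1 / 2) * k ^ 2 := by ring
  have : 0 ≤ (k : ℝ) * (m + 1) * m + (m + 1 / 2) * k ^ 2 := by positivity
  linarith

theorem wellPoised_le_zero_left (m k : ℕ) : wellPoised m k ≤ wellPoised 0 k := by
  induction m with
  | zero => exact le_rfl
  | succ m ih => exact (wellPoised_shift_le m k).trans ih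

theorem veryWellPoised_succ_le (m k : ℕ) : veryWellPoised m (k + 1) ≤ veryWellPoised m k := by
  have hw := wellPoised_pos m k
  have key : ((m : ℝ) + 1 / 2 + 2 * (k + 1)) * (((m : ℝ) + 1 / 2 + k) * ((k : ℝ) + 1 / 2) ^ 2) ≤
      ((m : ℝ) + 1 / 2 + 2 * k) * (((k : ℝ) + 1) * ((m : ℝ) + 1 + k) ^ 2) := by
    -- The difference expands to a polynomial in `m` and `k` with nonnegative coefficients.
    rw [← sub_nonneg]
    ring_nf
    positivity
  unfold veryWellPoised
  rw [wellPoised_succ, div_mul_eq_mul_div, div_mul_eq_mul_div]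
  push_cast
  refine div_le_div_of_nonneg_right ?_ (by positivity)
  rw [mul_left_comm, mul_comm _ (wellPoised m k)]
  refine mul_le_mul_of_nonneg_left ?_ hw.le
  rw [← mul_div_assoc, div_le_iff₀ (by positivity)]
  exact key

/-- The term at `k = 1` bounds the whole alternating tail, so its decay in `m` forces the sums
towards `1`. -/
theorem veryWellPoised_one_le (m : ℕ) : veryWellPoised m 1 ≤ 1 / ((m : ℝ) + 1) := by
  unfold veryWellPoised
  rw [wellPoised_succ, wellPoised_zero]
  have hm : (0 : ℝ) ≤ m := m.cast_nonneg
  have h1 : (0 : ℝ) < (m : ℝ) + 1 / 2 := by positivity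
  have h2 : (0 : ℝ) < (m : ℝ) + 1 := by positivity
  have : ((m : ℝ) + 1 / 2 + 2 * ((1 : ℕ) : ℝ)) / ((m : ℝ) + 1 / 2) * (1 *
      (((m : ℝ) + 1 / 2 + ((0 : ℕ) : ℝ)) * (((0 : ℕ) : ℝ) + 1 / 2) ^ 2 /
        ((((0 : ℕ) : ℝ) + 1) * ((m : ℝ) + 1 + ((0 : ℕ) : ℝ)) ^ 2))) =
      (m + 5 / 2) / (4 * (m + 1) ^ 2) := by
    push_cast
    simp only [add_zero]
    field_simp
    ring
  rw [this, div_le_div_iff₀ (by positivity) h2]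
  nlinarith

/-! ### Alternating sums -/

/-- Peeling off `f 0` leaves minus an alternating sum of the shifted sequence, which lies in `[0, f
1]` by induction. -/
theorem alternating_sum_mem_Icc {f : ℕ → ℝ} (hf : Antitone f) (h0 : ∀ k, 0 ≤ f k) (n : ℕ) :
    ∑ k ∈ Finset.range n, (-1) ^ k * f k ∈ Set.Icc 0 (f 0) := by
  induction n generalizing f with
  | zero => simpa using h0 0
  | succ n ih =>
    have h := ih (f := fun k => f (k + 1)) (fun a b hab => hf (by omega)) (fun k => h0 _)
    have hs : ∑ k ∈ Finset.range (n + 1), (-1) ^ k * f k =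
        f 0 - ∑ k ∈ Finset.range n, (-1) ^ k * f (k + 1) := by
      rw [Finset.sum_range_succ', add_comm, sub_eq_add_neg, ← Finset.sum_neg_distrib]
      simp [pow_succ]
    have h1 : f 1 ≤ f 0 := hf (by omega)
    rw [hs]
    exact ⟨by linarith [h.2], by linarith [h.1]⟩

/-- Partial sums of the very-well-poised series. -/
noncomputable def veryWellPoisedSum (m n : ℕ) : ℝ :=
  ∑ k ∈ Finset.range n, (-1) ^ k * veryWellPoised m k

theorem abs_veryWellPoisedSum_sub_one_le (m n : ℕ) :
    |veryWellPoisedSum m (n + 1) - 1| ≤ 1 / ((m : ℝ) + 1) := by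
  have h := alternating_sum_mem_Icc (f := fun k => veryWellPoised m (k + 1))
    (antitone_nat_of_succ_le fun k => veryWellPoised_succ_le m (k + 1))
    (fun k => (veryWellPoised_pos m _).le) n
  have h1 : (m : ℝ) + 1 / 2 ≠ 0 := by positivity
  have hs : veryWellPoisedSum m (n + 1) - 1 =
      -∑ k ∈ Finset.range n, (-1) ^ k * veryWellPoised m (k + 1) := by
    have h0 : veryWellPoised m 0 = 1 := by
      simp only [veryWellPoised, wellPoised_zero, Nat.cast_zero, mul_zero, add_zero, mul_one]
      exact div_self h1
    rw [veryWellPoisedSum, Finset.sum_range_succ', ← Finset.sum_neg_distrib, h0]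
    simp [pow_succ]
  rw [hs, abs_neg, abs_of_nonneg h.1]
  exact h.2.trans (veryWellPoised_one_le m)

/-- The Wilf–Zeilberger relation between consecutive values of the parameter. -/
theorem veryWellPoisedSum_eq (m n : ℕ) : veryWellPoisedSum m n =
    ((m : ℝ) + 1 / 2) * (m + 3 / 2) / (m + 1) ^ 2 * veryWellPoisedSum (m + 1) n -
      n * ((-1) ^ n * wellPoised m n) / (m + 1 / 2) := by
  -- The boundary term is the summed Wilf–Zeilberger certificate: it is zero at `n = 0`, and its
  -- increment accounts for the new terms on both sides.
  induction n with
  | zero => simp [veryWellPoisedSum]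
  | succ n ih =>
    have e : ∀ j, veryWellPoisedSum j (n + 1) =
        veryWellPoisedSum j n + (-1) ^ n * veryWellPoised j n :=
      fun j => Finset.sum_range_succ _ _
    rw [e, e, ih]
    unfold veryWellPoised
    rw [wellPoised_shift, wellPoised_succ, pow_succ]
    push_cast
    have h1 : (m : ℝ) + 1 / 2 ≠ 0 := by positivity
    have h2 : (m : ℝ) + 1 ≠ 0 := by positivity
    have h3 : (m : ℝ) + 1 + n ≠ 0 := by positivity
    have h4 : (m : ℝ) + 1 + 1 / 2 ≠ 0 := by positivity
    have h5 : (n : ℝ) + 1 ≠ 0 := by positivity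
    field_simp
    ring

/-! ### Size of the terms -/

theorem tHat_eq (k : ℕ) : tHat k = (-1) ^ k * wellPoised 0 k := by
  induction k with
  | zero => simp [tHat, wellPoised_zero]
  | succ k ih =>
    have hc : ((k : ℝ) + 1) * ((2 * (k + 1)).choose (k + 1) : ℝ) =
        2 * (2 * k + 1) * ((2 * k).choose k : ℝ) := by
      exact_mod_cast Nat.succ_mul_centralBinom_succ k
    have h1 : (k : ℝ) + 1 ≠ 0 := by positivity
    have hc' : ((2 * (k + 1)).choose (k + 1) : ℝ) =
        2 * (2 * k + 1) * ((2 * k).choose k : ℝ) / (k + 1) := by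
      rw [eq_div_iff h1, mul_comm, hc]
    have hs : tHat (k + 1) =
        tHat k * (-(((k : ℝ) + 1 / 2) ^ 3 / ((k : ℝ) + 1) ^ 3)) := by
      unfold tHat
      rw [hc', pow_succ (-64 : ℝ) k]
      have : (-64 : ℝ) ^ k ≠ 0 := pow_ne_zero _ (by norm_num)
      field_simp
      ring
    rw [hs, ih, wellPoised_succ, pow_succ]
    push_cast
    field_simp
    ring

theorem tHat_succ (k : ℕ) :
    tHat (k + 1) = tHat k * (-((2 * (k : ℝ) + 1) ^ 3 / (8 * ((k : ℝ) + 1) ^ 3))) := by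
  rw [tHat_eq, tHat_eq, wellPoised_succ, pow_succ]
  push_cast
  have h1 : (k : ℝ) + 1 ≠ 0 := by positivity
  field_simp
  ring

theorem abs_tHat (k : ℕ) : |tHat k| = wellPoised 0 k := by
  rw [tHat_eq, abs_mul, abs_pow, abs_neg, abs_one, one_pow, one_mul,
    abs_of_pos (wellPoised_pos 0 k)]

theorem tHat_ne_zero (k : ℕ) : tHat k ≠ 0 := by
  rw [← abs_pos, abs_tHat]
  exact wellPoised_pos 0 k

/-- This is the cube of the Wallis bound `(C(2k,k)/4^k)^2 (2k+1) ≤ 1`; the left side is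
nonincreasing in `k`. -/
theorem wellPoised_sq_mul_le (k : ℕ) : wellPoised 0 k ^ 2 * (2 * (k : ℝ) + 1) ^ 3 ≤ 1 := by
  induction k with
  | zero => simp [wellPoised_zero]
  | succ k ih =>
    refine le_trans ?_ ih
    rw [wellPoised_succ, mul_pow, mul_assoc]
    refine mul_le_mul_of_nonneg_left ?_ (sq_nonneg _)
    have hk : (0 : ℝ) ≤ k := k.cast_nonneg
    have h1 : (0 : ℝ) < (k : ℝ) + 1 := by positivity
    have e : (((((0 : ℕ) : ℝ) + 1 / 2 + k) * ((k : ℝ) + 1 / 2) ^ 2 /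
        (((k : ℝ) + 1) * (((0 : ℕ) : ℝ) + 1 + k) ^ 2))) ^ 2 *
        (2 * (((k + 1 : ℕ)) : ℝ) + 1) ^ 3 =
        ((2 * (k : ℝ) + 1) * (2 * k + 3) / (2 * k + 2) ^ 2) ^ 3 * (2 * (k : ℝ) + 1) ^ 3 := by
      push_cast
      have : 2 * (k : ℝ) + 2 = 2 * (k + 1) := by ring
      rw [this]
      field_simp
      ring
    rw [e]
    refine mul_le_of_le_one_left (by positivity) (pow_le_one₀ (by positivity) ?_)
    -- `(2k+1)(2k+3) = (2k+2)^2 - 1`.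
    rw [div_le_one (by positivity)]
    nlinarith

theorem wellPoised_le_rpow (k : ℕ) : wellPoised 0 k ≤ ((k : ℝ) + 1) ^ (-(3 / 2) : ℝ) := by
  have hk : (0 : ℝ) ≤ k := k.cast_nonneg
  have h1 : (0 : ℝ) < (k : ℝ) + 1 := by positivity
  refine le_of_sq_le_sq ?_ (Real.rpow_nonneg h1.le _)
  rw [← Real.rpow_mul_natCast h1.le, show (-(3 / 2) : ℝ) * ((2 : ℕ) : ℝ) = -((3 : ℕ) : ℝ) by norm_num,
    Real.rpow_neg h1.le, Real.rpow_natCast, ← one_div, le_div_iff₀ (by positivity)]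
  refine le_trans (mul_le_mul_of_nonneg_left ?_ (sq_nonneg _)) (wellPoised_sq_mul_le k)
  exact pow_le_pow_left₀ h1.le (by linarith) 3

theorem tendsto_mul_wellPoised :
    Tendsto (fun k : ℕ => (k : ℝ) * wellPoised 0 k) atTop (𝓝 0) := by
  have h : Tendsto (fun k : ℕ => ((k : ℝ) + 1) ^ (-(1 / 2) : ℝ)) atTop (𝓝 0) :=
    (tendsto_rpow_neg_atTop (by norm_num : (0 : ℝ) < 1 / 2)).comp
      (tendsto_atTop_add_const_right _ 1 tendsto_natCast_atTop_atTop)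
  refine squeeze_zero (fun k => mul_nonneg k.cast_nonneg (wellPoised_pos 0 k).le) (fun k => ?_) h
  have h1 : (0 : ℝ) < (k : ℝ) + 1 := by positivity
  calc (k : ℝ) * wellPoised 0 k ≤ ((k : ℝ) + 1) * ((k : ℝ) + 1) ^ (-(3 / 2) : ℝ) :=
        mul_le_mul (by linarith) (wellPoised_le_rpow k) (wellPoised_pos 0 k).le h1.le
    _ = ((k : ℝ) + 1) ^ (-(1 / 2) : ℝ) := by
        rw [← Real.rpow_one_add' h1.le (by norm_num)]
        norm_num

theorem summable_wellPoised : Summable (fun k : ℕ => wellPoised 0 k) := by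
  have h : Summable (fun k : ℕ => (((k + 1 : ℕ)) : ℝ) ^ (-(3 / 2) : ℝ)) :=
    (summable_nat_add_iff 1).2 (Real.summable_nat_rpow.2 (by norm_num))
  refine Summable.of_nonneg_of_le (fun k => (wellPoised_pos 0 k).le) (fun k => ?_) h
  simpa using wellPoised_le_rpow k

/-! ### Bauer's series -/

/-- Iterating the Wilf–Zeilberger relation `M` times multiplies reciprocals of Wallis factors, and
each boundary term vanishes as `n → ∞`. Convergence of either sum is not presupposed. -/
theorem tendsto_veryWellPoisedSum_sub (M : ℕ) :
    Tendsto (fun n => veryWellPoisedSum 0 n - (Real.Wallis.W M)⁻¹ * veryWellPoisedSum M n)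
      atTop (𝓝 0) := by
  induction M with
  | zero => simp [Real.Wallis.W]
  | succ M ih =>
    have hw : Tendsto (fun n : ℕ => (n : ℝ) * ((-1) ^ n * wellPoised M n)) atTop (𝓝 0) := by
      refine squeeze_zero_norm (fun n => ?_) tendsto_mul_wellPoised
      rw [Real.norm_eq_abs, abs_mul, abs_mul, abs_pow, abs_neg, abs_one, one_pow, one_mul,
        abs_of_pos (wellPoised_pos M n), Nat.abs_cast]
      exact mul_le_mul_of_nonneg_left (wellPoised_le_zero_left M n) n.cast_nonneg
    have h := ih.sub (hw.const_mul ((Real.Wallis.W M)⁻¹ / ((M : ℝ) + 1 / 2)))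
    simp only [mul_zero, sub_zero] at h
    refine h.congr fun n => ?_
    rw [Real.Wallis.W_succ, mul_inv, veryWellPoisedSum_eq M n]
    have h1 : (M : ℝ) + 1 / 2 ≠ 0 := by positivity
    have h2 : (M : ℝ) + 1 ≠ 0 := by positivity
    have h3 : 2 * (M : ℝ) + 1 ≠ 0 := by positivity
    have h4 : 2 * (M : ℝ) + 2 = 2 * (M + 1) := by ring
    have h5 : 2 * (M : ℝ) + 3 ≠ 0 := by positivity
    have e : ((2 * (M : ℝ) + 2) / (2 * M + 1) * ((2 * M + 2) / (2 * M + 3)))⁻¹ =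
        ((M : ℝ) + 1 / 2) * (M + 3 / 2) / (M + 1) ^ 2 := by
      rw [h4]
      field_simp
    rw [e]
    ring

theorem tendsto_veryWellPoisedSum_zero :
    Tendsto (fun n => veryWellPoisedSum 0 n) atTop (𝓝 (2 / Real.pi)) := by
  have hW : Tendsto (fun M => (Real.Wallis.W M)⁻¹) atTop (𝓝 (2 / Real.pi)) := by
    have := Real.tendsto_prod_pi_div_two.inv₀ (by positivity : Real.pi / 2 ≠ 0)
    rwa [inv_div] at this
  have hB : Tendsto (fun M : ℕ => (Real.Wallis.W M)⁻¹ * (1 / ((M : ℝ) + 1)) +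
      |(Real.Wallis.W M)⁻¹ - 2 / Real.pi|) atTop (𝓝 0) := by
    have h1 := hW.mul tendsto_one_div_add_atTop_nhds_zero_nat
    have h2 := (hW.sub_const (2 / Real.pi)).abs
    simpa using h1.add h2
  rw [Metric.tendsto_atTop]
  intro ε hε
  -- `M` is fixed before `n`: the errors collected in `hB` do not depend on `n`.
  obtain ⟨M, hM⟩ := (hB.eventually (gt_mem_nhds (half_pos hε))).exists
  obtain ⟨N, hN⟩ := Metric.tendsto_atTop.1 (tendsto_veryWellPoisedSum_sub M) (ε / 2) (half_pos hε)
  refine ⟨N + 1, fun n hn => ?_⟩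
  -- The empty sum is `0`, so closeness to `1` needs at least one term.
  obtain ⟨n, rfl⟩ : ∃ j, n = j + 1 := ⟨n - 1, by omega⟩
  have h1 := hN (n + 1) (by omega)
  have h2 := abs_veryWellPoisedSum_sub_one_le M n
  have hp := Real.Wallis.W_pos M
  rw [Real.dist_eq, sub_zero] at h1
  rw [Real.dist_eq]
  have h3 : |(Real.Wallis.W M)⁻¹ * (veryWellPoisedSum M (n + 1) - 1)| ≤
      (Real.Wallis.W M)⁻¹ * (1 / ((M : ℝ) + 1)) := by
    rw [abs_mul, abs_of_pos (inv_pos.2 hp)]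
    exact mul_le_mul_of_nonneg_left h2 (inv_pos.2 hp).le
  have e : veryWellPoisedSum 0 (n + 1) - 2 / Real.pi =
      (veryWellPoisedSum 0 (n + 1) - (Real.Wallis.W M)⁻¹ * veryWellPoisedSum M (n + 1)) +
      (Real.Wallis.W M)⁻¹ * (veryWellPoisedSum M (n + 1) - 1) +
      ((Real.Wallis.W M)⁻¹ - 2 / Real.pi) := by ring
  rw [e]
  refine (abs_add_three _ _ _).trans_lt ?_
  linarith

theorem tendsto_sum_bauerTerm :
    Tendsto (fun n : ℕ => ∑ k ∈ Finset.range n, bauerTerm k) atTop (𝓝 (2 / Real.pi)) := by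
  refine tendsto_veryWellPoisedSum_zero.congr fun n => Finset.sum_congr rfl fun k _ => ?_
  rw [bauerTerm, tHat_eq, veryWellPoised]
  push_cast
  ring

/-! ### Telescoping -/

theorem tendsto_mul_tHat_of_abs_le {r : ℕ → ℝ} {C : ℝ} (hr : ∀ k : ℕ, |r k| ≤ C * ((k : ℝ) + 1)) :
    Tendsto (fun k => r k * tHat k) atTop (𝓝 0) := by
  have h := (tendsto_mul_wellPoised.add summable_wellPoised.tendsto_atTop_zero).const_mul C
  rw [add_zero, mul_zero] at h
  refine squeeze_zero_norm (fun k => ?_) h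
  rw [Real.norm_eq_abs, abs_mul, abs_tHat]
  calc |r k| * wellPoised 0 k ≤ C * ((k : ℝ) + 1) * wellPoised 0 k :=
        mul_le_mul_of_nonneg_right (hr k) (wellPoised_pos 0 k).le
    _ = _ := by ring

/-- Boundedness of `r` gives absolute convergence, so the sum may be read off from ordered partial
sums. This matters because Bauer's series enters only as a limit of partial sums. -/
theorem hasSum_mul_tHat_of_telescoping {r g : ℕ → ℝ} {C α : ℝ} (hα : α ≠ 0)
    (hr : ∀ k, |r k| ≤ C) (h : ∀ k, bauerTerm k + α * r k * tHat k = g (k + 1) - g k)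
    (hg : Tendsto g atTop (𝓝 0)) :
    HasSum (fun k => r k * tHat k) (-(g 0 + 2 / Real.pi) / α) := by
  have hs : Summable (fun k => r k * tHat k) := by
    refine Summable.of_norm_bounded (summable_wellPoised.mul_left C) fun k => ?_
    rw [Real.norm_eq_abs, abs_mul, abs_tHat]
    exact mul_le_mul_of_nonneg_right (hr k) (wellPoised_pos 0 k).le
  refine (hs.hasSum_iff_tendsto_nat).2 ?_
  have hlim := ((hg.sub_const (g 0)).sub tendsto_sum_bauerTerm).div_const α
  have e : (0 - g 0 - 2 / Real.pi) / α = -(g 0 + 2 / Real.pi) / α := by ring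
  rw [e] at hlim
  refine hlim.congr fun n => ?_
  rw [← Finset.sum_range_sub, ← Finset.sum_sub_distrib, Finset.sum_div]
  refine Finset.sum_congr rfl fun k _ => ?_
  rw [← h k]
  field_simp
  ring

theorem two_mul_natCast_sub_one_ne_zero (k : ℕ) : 2 * (k : ℝ) - 1 ≠ 0 := by
  intro h
  have h2 : ((2 * k : ℕ) : ℝ) = (1 : ℕ) := by push_cast; linarith
  have := Nat.cast_injective h2
  omega

/-! ### Gosper representation and telescoping identities -/

theorem isGosperRepresentation_bauerTerm : IsGosperRepresentation bauerTerm
    (-(2 * X + 1) ^ 3 : ℝ[X]) (8 * (X + 1) ^ 3 : ℝ[X]) (4 * X + 1 : ℝ[X]) := by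
  have ne_of_eval {p : ℝ[X]} (h : p.eval 0 ≠ 0) : p ≠ 0 := by
    rintro rfl
    simp at h
  refine ⟨ne_of_eval (by simp), ne_of_eval (by simp), ne_of_eval (by simp), fun h => ?_,
    fun k => ⟨?_, ?_, ?_, ?_⟩⟩
  · have hh : (2 * (h : ℝ) + 1) ≠ 0 := by positivity
    have lin : IsCoprime (2 * X + 1 : ℝ[X]) (X + C (h : ℝ) + 1) := by
      -- Bézout: `2(X + h + 1) - (2X + 1) = 2h + 1`, a nonzero constant.
      refine ⟨-C ((2 * (h : ℝ) + 1)⁻¹), 2 * C ((2 * (h : ℝ) + 1)⁻¹), ?_⟩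
      have e : C ((2 * (h : ℝ) + 1)⁻¹) * (2 * C (h : ℝ) + 1) = 1 := by
        have : (2 * C (h : ℝ) + 1 : ℝ[X]) = C (2 * (h : ℝ) + 1) := by
          rw [C_add, C_mul, C_1]
          rfl
        rw [this, ← C_mul, inv_mul_cancel₀ hh, C_1]
      linear_combination e
    have u8 : IsUnit (8 : ℝ[X]) := by
      have : (8 : ℝ[X]) = C 8 := rfl
      rw [this, isUnit_C]
      norm_num
    simp only [mul_comp, pow_comp, add_comp, X_comp, one_comp, ofNat_comp]
    exact ((isCoprime_mul_unit_left_right u8 _ _).2 lin.pow).neg_left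
  · exact mul_ne_zero (by positivity) (tHat_ne_zero k)
  · simp
    positivity
  · simp
    positivity
  · have h1 : 4 * (k : ℝ) + 1 ≠ 0 := by positivity
    have h2 : (k : ℝ) + 1 ≠ 0 := by positivity
    have h3 := tHat_ne_zero k
    rw [bauerTerm, bauerTerm, tHat_succ]
    simp
    field_simp

theorem bauerTerm_add_eq_sub_g₁ (k : ℕ) :
    bauerTerm k + (8 * (k : ℝ) ^ 2 - 2 * (k : ℝ)) / (2 * (k : ℝ) - 1) ^ 2 * tHat k =
      g₁ (k + 1) - g₁ k := by
  unfold g₁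
  rw [bauerTerm, tHat_succ]
  push_cast
  have h1 := two_mul_natCast_sub_one_ne_zero k
  have h2 : (k : ℝ) + 1 ≠ 0 := by positivity
  have h3 : 2 * (k : ℝ) + 1 ≠ 0 := by positivity
  rw [show 2 * ((k : ℝ) + 1) - 1 = 2 * k + 1 by ring]
  -- Denominators are cleared with `2k - 1` as a single nonzero atom; what remains after
  -- substituting back is a polynomial identity.
  generalize hd : 2 * (k : ℝ) - 1 = d at h1 ⊢
  field_simp
  rw [← hd]
  ring

theorem bauerTerm_sub_eq_sub_g₂ (k : ℕ) :
    bauerTerm k - 1 / 4 * ((4 * (k : ℝ) + 3) * (2 * (k : ℝ) + 1) / ((k : ℝ) + 1) ^ 2) * tHat k =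
      g₂ (k + 1) - g₂ k := by
  unfold g₂
  rw [bauerTerm, tHat_succ]
  push_cast
  have h2 : (k : ℝ) + 1 ≠ 0 := by positivity
  field_simp
  ring

theorem bauerTerm_add_eq_sub_g₃ (k : ℕ) :
    bauerTerm k + 1 / 2 * ((4 * (k : ℝ) + 1) / (((k : ℝ) + 1) * (2 * (k : ℝ) - 1))) * tHat k =
      g₃ (k + 1) - g₃ k := by
  unfold g₃
  rw [bauerTerm, tHat_succ]
  push_cast
  have h1 := two_mul_natCast_sub_one_ne_zero k
  have h2 : (k : ℝ) + 1 ≠ 0 := by positivity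
  have h3 : 2 * (k : ℝ) + 1 ≠ 0 := by positivity
  rw [show 2 * ((k : ℝ) + 1) - 1 = 2 * k + 1 by ring]
  generalize hd : 2 * (k : ℝ) - 1 = d at h1 ⊢
  field_simp
  rw [← hd]
  ring

theorem bauerTerm_sub_eq_sub_g₄ (k : ℕ) :
    bauerTerm k - (4 * (k : ℝ) - 1) / (2 * (k : ℝ) - 1) ^ 3 * tHat k = g₄ (k + 1) - g₄ k := by
  unfold g₄
  rw [bauerTerm, tHat_succ]
  push_cast
  have h1 := two_mul_natCast_sub_one_ne_zero k
  have h2 : (k : ℝ) + 1 ≠ 0 := by positivity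
  have h3 : 2 * (k : ℝ) + 1 ≠ 0 := by positivity
  rw [show 2 * ((k : ℝ) + 1) - 1 = 2 * k + 1 by ring]
  generalize hd : 2 * (k : ℝ) - 1 = d at h1 ⊢
  field_simp
  rw [← hd]
  ring

theorem bauerTerm_add_eq_sub_g₅ (k : ℕ) :
    bauerTerm k + 1 / 8 * ((4 * (k : ℝ) + 3) / ((k : ℝ) + 1) ^ 3) * tHat k =
      g₅ (k + 1) - g₅ k := by
  unfold g₅
  rw [bauerTerm, tHat_succ]
  push_cast
  have h2 : (k : ℝ) + 1 ≠ 0 := by positivity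
  field_simp
  ring

/-! ### Decay of the telescoped sequences -/

theorem abs_div_le_of_abs_le_mul {a b C : ℝ} (hb : b ≠ 0) (h : |a| ≤ C * |b|) : |a / b| ≤ C := by
  rwa [abs_div, div_le_iff₀ (abs_pos.2 hb)]

theorem one_le_abs_two_mul_natCast_sub_one (k : ℕ) : 1 ≤ |2 * (k : ℝ) - 1| := by
  rcases Nat.eq_zero_or_pos k with rfl | hk
  · simp
  · have : (1 : ℝ) ≤ k := by exact_mod_cast hk
    exact le_abs.2 (Or.inl (by linarith))

/-- Average of `1 ≤ |2k-1|` and `2k-1 ≤ |2k-1|`. It cancels powers of `k` against the denominators,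
leaving linear growth. -/
theorem natCast_le_abs_two_mul_sub_one (k : ℕ) : (k : ℝ) ≤ |2 * (k : ℝ) - 1| := by
  have h := one_le_abs_two_mul_natCast_sub_one k
  have h2 := le_abs_self (2 * (k : ℝ) - 1)
  linarith

theorem tendsto_g₁ : Tendsto g₁ atTop (𝓝 0) := by
  refine tendsto_mul_tHat_of_abs_le (C := 8) fun k => ?_
  have hk : (0 : ℝ) ≤ k := k.cast_nonneg
  rw [abs_neg]
  refine abs_div_le_of_abs_le_mul (pow_ne_zero _ (two_mul_natCast_sub_one_ne_zero k)) ?_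
  rw [abs_of_nonneg (by positivity), abs_pow]
  calc 8 * (k : ℝ) ^ 3 = 8 * k * (k : ℝ) ^ 2 := by ring
    _ ≤ 8 * (k + 1) * |2 * (k : ℝ) - 1| ^ 2 := by
      gcongr
      · linarith
      · exact natCast_le_abs_two_mul_sub_one k

theorem tendsto_g₂ : Tendsto g₂ atTop (𝓝 0) := by
  refine tendsto_mul_tHat_of_abs_le (C := 2) fun k => ?_
  rw [abs_neg, abs_of_nonneg (by positivity)]
  linarith

theorem tendsto_g₃ : Tendsto g₃ atTop (𝓝 0) := by
  refine tendsto_mul_tHat_of_abs_le (C := 4) fun k => ?_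
  have hk : (0 : ℝ) ≤ k := k.cast_nonneg
  rw [abs_neg]
  refine abs_div_le_of_abs_le_mul (two_mul_natCast_sub_one_ne_zero k) ?_
  rw [abs_of_nonneg (by positivity)]
  calc 4 * (k : ℝ) ^ 2 = 4 * k * k := by ring
    _ ≤ 4 * (k + 1) * |2 * (k : ℝ) - 1| := by
      gcongr
      · linarith
      · exact natCast_le_abs_two_mul_sub_one k

theorem tendsto_g₄ : Tendsto g₄ atTop (𝓝 0) := by
  refine tendsto_mul_tHat_of_abs_le (C := 16) fun k => ?_
  have hk : (0 : ℝ) ≤ k := k.cast_nonneg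
  rw [abs_neg]
  refine abs_div_le_of_abs_le_mul (pow_ne_zero _ (two_mul_natCast_sub_one_ne_zero k)) ?_
  rw [abs_mul, abs_of_nonneg (by positivity : (0 : ℝ) ≤ 16 * (k : ℝ) ^ 3), abs_pow]
  have h1 : |(k : ℝ) - 1| ≤ k + 1 := abs_le.2 ⟨by linarith, by linarith⟩
  calc 16 * (k : ℝ) ^ 3 * |(k : ℝ) - 1| ≤ 16 * |2 * (k : ℝ) - 1| ^ 3 * (k + 1) := by
        gcongr
        exact natCast_le_abs_two_mul_sub_one k
    _ = 16 * (k + 1) * |2 * (k : ℝ) - 1| ^ 3 := by ring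

theorem tendsto_g₅ : Tendsto g₅ atTop (𝓝 0) := by
  refine tendsto_mul_tHat_of_abs_le (C := 2) fun k => ?_
  rw [abs_neg, abs_of_nonneg (by positivity)]
  linarith

/-! ### Values of the five series -/

theorem hasSum_denominator_two_mul_sub_one_sq :
    HasSum (fun k : ℕ => (k : ℝ) * (4 * (k : ℝ) - 1) / (2 * (k : ℝ) - 1) ^ 2 * tHat k)
      (-1 / Real.pi) := by
  -- `α = 2` because `8k^2 - 2k = 2 · k(4k - 1)`.
  have h := hasSum_mul_tHat_of_telescoping (α := 2) (C := 10) (g := g₁)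
    (r := fun k : ℕ => (k : ℝ) * (4 * (k : ℝ) - 1) / (2 * (k : ℝ) - 1) ^ 2) two_ne_zero
    (fun k => ?_) (fun k => ?_) tendsto_g₁
  · convert h using 1
    simp only [g₁]
    field_simp
    simp
  · refine abs_div_le_of_abs_le_mul (pow_ne_zero _ (two_mul_natCast_sub_one_ne_zero k)) ?_
    have h1 : 1 ≤ (2 * (k : ℝ) - 1) ^ 2 :=
      (one_le_sq_iff_one_le_abs _).2 (one_le_abs_two_mul_natCast_sub_one k)
    rw [abs_of_nonneg (sq_nonneg (2 * (k : ℝ) - 1)), abs_le]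
    constructor <;> nlinarith
  · rw [← bauerTerm_add_eq_sub_g₁]
    ring

theorem hasSum_denominator_add_one_sq :
    HasSum (fun k : ℕ => (4 * (k : ℝ) + 3) * (2 * (k : ℝ) + 1) / ((k : ℝ) + 1) ^ 2 * tHat k)
      (8 / Real.pi) := by
  have h := hasSum_mul_tHat_of_telescoping (α := -1 / 4) (C := 8) (g := g₂)
    (r := fun k : ℕ => (4 * (k : ℝ) + 3) * (2 * (k : ℝ) + 1) / ((k : ℝ) + 1) ^ 2) (by norm_num)
    (fun k => ?_) (fun k => ?_) tendsto_g₂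
  · convert h using 1
    simp only [g₂]
    field_simp
    norm_num
  · rw [abs_of_nonneg (by positivity), div_le_iff₀ (by positivity)]
    have hk : (0 : ℝ) ≤ k := k.cast_nonneg
    nlinarith
  · rw [← bauerTerm_sub_eq_sub_g₂]
    ring

theorem hasSum_denominator_add_one_mul_two_mul_sub_one :
    HasSum (fun k : ℕ => (4 * (k : ℝ) + 1) / (((k : ℝ) + 1) * (2 * (k : ℝ) - 1)) * tHat k)
      (-4 / Real.pi) := by
  have h := hasSum_mul_tHat_of_telescoping (α := 1 / 2) (C := 4) (g := g₃)
    (r := fun k : ℕ => (4 * (k : ℝ) + 1) / (((k : ℝ) + 1) * (2 * (k : ℝ) - 1))) (by norm_num)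
    (fun k => ?_) (fun k => ?_) tendsto_g₃
  · convert h using 1
    simp only [g₃]
    field_simp
    norm_num
  · have h2 : (0 : ℝ) < (k : ℝ) + 1 := by positivity
    refine abs_div_le_of_abs_le_mul (mul_ne_zero h2.ne' (two_mul_natCast_sub_one_ne_zero k)) ?_
    rw [abs_mul, abs_of_pos h2, abs_of_nonneg (by positivity)]
    have := mul_le_mul_of_nonneg_left (one_le_abs_two_mul_natCast_sub_one k) h2.le
    linarith
  · exact bauerTerm_add_eq_sub_g₃ k

theorem hasSum_denominator_two_mul_sub_one_cube :
    HasSum (fun k : ℕ => (4 * (k : ℝ) - 1) / (2 * (k : ℝ) - 1) ^ 3 * tHat k)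
      (2 / Real.pi) := by
  have h := hasSum_mul_tHat_of_telescoping (α := -1) (C := 3) (g := g₄)
    (r := fun k : ℕ => (4 * (k : ℝ) - 1) / (2 * (k : ℝ) - 1) ^ 3) (by norm_num)
    (fun k => ?_) (fun k => ?_) tendsto_g₄
  · convert h using 1
    simp only [g₄]
    field_simp
    simp
  · refine abs_div_le_of_abs_le_mul (pow_ne_zero _ (two_mul_natCast_sub_one_ne_zero k)) ?_
    have h1 := one_le_abs_two_mul_natCast_sub_one k
    have h2 : |2 * (k : ℝ) - 1| ≤ |2 * (k : ℝ) - 1| ^ 3 := le_self_pow₀ h1 (by norm_num)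
    have h3 : |4 * (k : ℝ) - 1| ≤ 2 * |2 * (k : ℝ) - 1| + 1 := by
      have := abs_add_le (2 * (2 * (k : ℝ) - 1)) 1
      rw [abs_mul, abs_one, abs_two] at this
      rwa [show 4 * (k : ℝ) - 1 = 2 * (2 * k - 1) + 1 by ring]
    rw [abs_pow]
    linarith
  · rw [← bauerTerm_sub_eq_sub_g₄]
    ring

/-- The constant `8` comes from the nonzero initial value `g₅ 0 = -1`, divided by `α = 1/8`. -/
theorem hasSum_denominator_add_one_cube :
    HasSum (fun k : ℕ => (4 * (k : ℝ) + 3) / ((k : ℝ) + 1) ^ 3 * tHat k)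
      (8 - 16 / Real.pi) := by
  have h := hasSum_mul_tHat_of_telescoping (α := 1 / 8) (C := 4) (g := g₅)
    (r := fun k : ℕ => (4 * (k : ℝ) + 3) / ((k : ℝ) + 1) ^ 3) (by norm_num)
    (fun k => ?_) (fun k => ?_) tendsto_g₅
  · convert h using 1
    simp only [g₅, tHat]
    field_simp
    norm_num
    ring
  · rw [abs_of_nonneg (by positivity), div_le_iff₀ (by positivity)]
    have hk : (1 : ℝ) ≤ (k : ℝ) + 1 := by linarith [k.cast_nonneg (α := ℝ)]
    have : (k : ℝ) + 1 ≤ ((k : ℝ) + 1) ^ 3 := le_self_pow₀ hk (by norm_num)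
    linarith
  · exact bauerTerm_add_eq_sub_g₅ k

theorem mainTheorem5 :
    -- Bauer's series, which converges only conditionally
    Tendsto (fun n : ℕ => ∑ k ∈ Finset.range n,
      (4 * (k : ℝ) + 1) * ((2 * k).choose k : ℝ) ^ 3 / (-64 : ℝ) ^ k) atTop (𝓝 (2 / Real.pi)) ∧
    -- the Gosper representation of its term
    IsGosperRepresentation bauerTerm
      (-(2 * X + 1) ^ 3 : ℝ[X]) (8 * (X + 1) ^ 3 : ℝ[X]) (4 * X + 1 : ℝ[X]) ∧
    -- denominator `(2k-1)^2`
    ((∀ k : ℕ, bauerTerm k + (8 * (k : ℝ) ^ 2 - 2 * (k : ℝ)) / (2 * (k : ℝ) - 1) ^ 2 * tHat k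
        = g₁ (k + 1) - g₁ k) ∧
      Tendsto g₁ atTop (𝓝 0) ∧ g₁ 0 = 0 ∧
      HasSum (fun k : ℕ => (k : ℝ) * (4 * (k : ℝ) - 1) / (2 * (k : ℝ) - 1) ^ 2 *
        (((2 * k).choose k : ℝ) ^ 3 / (-64 : ℝ) ^ k)) (-1 / Real.pi)) ∧
    -- denominator `(k+1)^2`
    ((∀ k : ℕ, bauerTerm k -
        1 / 4 * ((4 * (k : ℝ) + 3) * (2 * (k : ℝ) + 1) / ((k : ℝ) + 1) ^ 2) * tHat k
        = g₂ (k + 1) - g₂ k) ∧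
      Tendsto g₂ atTop (𝓝 0) ∧ g₂ 0 = 0 ∧
      HasSum (fun k : ℕ => (4 * (k : ℝ) + 3) * (2 * (k : ℝ) + 1) / ((k : ℝ) + 1) ^ 2 *
        (((2 * k).choose k : ℝ) ^ 3 / (-64 : ℝ) ^ k)) (8 / Real.pi)) ∧
    -- denominator `(k+1)(2k-1)`
    ((∀ k : ℕ, bauerTerm k +
        1 / 2 * ((4 * (k : ℝ) + 1) / (((k : ℝ) + 1) * (2 * (k : ℝ) - 1))) * tHat k
        = g₃ (k + 1) - g₃ k) ∧
      Tendsto g₃ atTop (𝓝 0) ∧ g₃ 0 = 0 ∧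
      HasSum (fun k : ℕ => (4 * (k : ℝ) + 1) / (((k : ℝ) + 1) * (2 * (k : ℝ) - 1)) *
        (((2 * k).choose k : ℝ) ^ 3 / (-64 : ℝ) ^ k)) (-4 / Real.pi)) ∧
    -- denominator `(2k-1)^3`
    ((∀ k : ℕ, bauerTerm k - (4 * (k : ℝ) - 1) / (2 * (k : ℝ) - 1) ^ 3 * tHat k
        = g₄ (k + 1) - g₄ k) ∧
      Tendsto g₄ atTop (𝓝 0) ∧ g₄ 0 = 0 ∧
      HasSum (fun k : ℕ => (4 * (k : ℝ) - 1) / (2 * (k : ℝ) - 1) ^ 3 *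
        (((2 * k).choose k : ℝ) ^ 3 / (-64 : ℝ) ^ k)) (2 / Real.pi)) ∧
    -- denominator `(k+1)^3`
    ((∀ k : ℕ, bauerTerm k + 1 / 8 * ((4 * (k : ℝ) + 3) / ((k : ℝ) + 1) ^ 3) * tHat k
        = g₅ (k + 1) - g₅ k) ∧
      Tendsto g₅ atTop (𝓝 0) ∧ g₅ 0 = -1 ∧
      HasSum (fun k : ℕ => (4 * (k : ℝ) + 3) / ((k : ℝ) + 1) ^ 3 *
        (((2 * k).choose k : ℝ) ^ 3 / (-64 : ℝ) ^ k)) (8 - 16 / Real.pi)) := by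
  refine ⟨tendsto_sum_bauerTerm.congr fun n => Finset.sum_congr rfl fun k _ => ?_,
    isGosperRepresentation_bauerTerm,
    ⟨bauerTerm_add_eq_sub_g₁, tendsto_g₁, by simp [g₁], hasSum_denominator_two_mul_sub_one_sq⟩,
    ⟨bauerTerm_sub_eq_sub_g₂, tendsto_g₂, by simp [g₂], hasSum_denominator_add_one_sq⟩,
    ⟨bauerTerm_add_eq_sub_g₃, tendsto_g₃, by simp [g₃],
      hasSum_denominator_add_one_mul_two_mul_sub_one⟩,
    ⟨bauerTerm_sub_eq_sub_g₄, tendsto_g₄, by simp [g₄], hasSum_denominator_two_mul_sub_one_cube⟩,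
    ⟨bauerTerm_add_eq_sub_g₅, tendsto_g₅, by simp [g₅, tHat], hasSum_denominator_add_one_cube⟩⟩
  rw [bauerTerm, tHat, mul_div_assoc]
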